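/- Let $G=(V,E)$ be a finite simple graph. Let $\mathcal K(G)$ be the set of inclusion-wise maximal cliques of $G$, $\mathcal T(G)$ the set of its triangles, and $\mathcal I(G)$ the set of its induced paths with at least one edge; triangles and paths are identified with their vertex sets. For $K\subseteq V$ let $\mathcal T_K^i$ be the set of triangles with exactly $i$ vertices in $K$ and $\mathcal I_K^i$ the set of paths in $\mathcal I(G)$ with at least $i$ vertices in $K$; write $\mathcal T_v^1,\mathcal I_v^1$ for $K=\{v\}$, i.e. the triangles, respectively paths, that contain $v$. For a vector $y$ and a set $S$ of its indices, let $y(S)=\sum_{s\in S}y_s$. Let $P(G)$ be the set of all $(x,t,p)\in\mathbb R^{V}\times\mathbb R^{\mathcal T(G)}\times\mathbb R^{\mathcal I(G)}$ such that $$x(K)-t(\mathcal T_K^2)-2\,t(\mathcal T_K^3)-p(\mathcal I_K^2)\le 1\quad\text{for all }K\in\mathcal K(G),$$ $$t(\mathcal T_v^1)+p(\mathcal I_v^1)\le x_v\quad\text{for all }v\in V,\qquad p\ge 0,\quad t\ge 0.$$ Then $P(G)$ is a polytope (a bounded polyhedron), and $G$ is chordal (it has no induced cycle of length at least $4$) if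 and only if $P(G)$ is integer, that is, every nonempty face of $P(G)$ contains a point all of whose coordinates are integers. -/

import Mathlib

namespace CoThreePlex

variable {V : Type*}

/-- `G` is chordal: it has no hole (induced cycle) on four or more vertices. -/
def IsChordal (G : SimpleGraph V) : Prop :=
  ∀ n : ℕ, 4 ≤ n → ¬ (SimpleGraph.cycleGraph n).IsIndContained G

/-- The set of vertices `P` can be ordered into a sequence of at least two vertices that induces
a path of `G`, that is, `P` induces a path with at least one edge. -/
def InducesPath (G : SimpleGraph V) (P : Finset V) : Prop :=
  ∃ n : ℕ, 2 ≤ n ∧ ∃ f : SimpleGraph.pathGraph n ↪g G, Set.range f = (P : Set V)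

/-- The triangles of `G`, given by their vertex sets. -/
abbrev Triangle (G : SimpleGraph V) : Type _ := {T : Finset V // G.IsNClique 3 T}

/-- The induced paths of `G` with at least one edge, given by their vertex sets. -/
abbrev IndPath (G : SimpleGraph V) : Type _ := {P : Finset V // InducesPath G P}

/-- `K` is an inclusion-wise maximal clique of `G`. -/
def IsMaxClique (G : SimpleGraph V) (K : Finset V) : Prop :=
  Maximal (fun S : Finset V => G.IsClique (S : Set V)) K

/-- The space of the variables `(x, t, p)`: `x` on the vertices, `t` on the triangles and `p` on
the induced paths with at least one edge. -/
abbrev VarSpace (G : SimpleGraph V) : Type _ := (V → ℝ) × (Triangle G → ℝ) × (IndPath G → ℝ)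

open Classical in
/-- The triangles with exactly `i` vertices in `K`. -/
noncomputable def trianglesMeeting [Fintype V] (G : SimpleGraph V) (K : Finset V) (i : ℕ) :
    Finset (Triangle G) :=
  Finset.univ.filter fun T => (T.1 ∩ K).card = i

open Classical in
/-- The induced paths with at least `i` vertices in `K`. -/
noncomputable def pathsMeeting [Fintype V] (G : SimpleGraph V) (K : Finset V) (i : ℕ) :
    Finset (IndPath G) :=
  Finset.univ.filter fun P => i ≤ (P.1 ∩ K).card

/-- The polyhedron in the variables `(x, t, p)` given by the clique inequalities, the star
inequalities and the nonnegativity of `t` and `p`. -/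
def polytope [Fintype V] (G : SimpleGraph V) : Set (VarSpace G) :=
  {(x, t, p) |
    (∀ K : Finset V, IsMaxClique G K →
      ∑ v ∈ K, x v - ∑ T ∈ trianglesMeeting G K 2, t T - 2 * ∑ T ∈ trianglesMeeting G K 3, t T
        - ∑ P ∈ pathsMeeting G K 2, p P ≤ 1) ∧
    (∀ v : V, ∑ T ∈ trianglesMeeting G {v} 1, t T + ∑ P ∈ pathsMeeting G {v} 1, p P ≤ x v) ∧
    (∀ P, 0 ≤ p P) ∧ (∀ T, 0 ≤ t T)}

/-- All coordinates of the point are integers. -/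
def IsIntegerPoint {G : SimpleGraph V} (y : VarSpace G) : Prop :=
  (∀ v, ∃ m : ℤ, y.1 v = m) ∧ (∀ T, ∃ m : ℤ, y.2.1 T = m) ∧ (∀ P, ∃ m : ℤ, y.2.2 P = m)

/-- A polyhedron is integer if each of its nonempty faces contains an integer point. The nonempty
faces are the sets of maximizers of linear functionals over the polyhedron (the zero functional
gives the polyhedron itself). -/
def IsInteger {G : SimpleGraph V} (Q : Set (VarSpace G)) : Prop :=
  ∀ F : Set (VarSpace G), IsExposed ℝ Q F → F.Nonempty → ∃ y ∈ F, IsIntegerPoint y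

end CoThreePlex

namespace CoThreePlex

/-! Replacing each `x v` by the slack of its star inequality is a linear bijection that preserves
integrality in both directions. It turns the polytope into the fractional packings of pieces
(vertices, triangles, induced paths): nonnegative weights such that the pieces meeting any given
maximal clique weigh at most 1 in total. Boundedness is then immediate.

If `G` is chordal, any family of connected sets has a member whose touching members all meet one
clique (`exists_simplicial_index`, from Dirac's theorem). A local ratio argument (`exists_packing`)
then finds, for each linear objective, an optimal 0/1 packing.

If `G` has a hole, two adjacent hole vertices and the path formed by the rest are three pairwise
touching pieces that no clique meets at once. The sum of their weights has maximum 3/2, so its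
optimal face has no integer point. -/

/-! ### Dirac's theorem on simplicial vertices -/

theorem cycleGraph_adj_iff_val {n : ℕ} (hn : 3 ≤ n) (a b : Fin n) :
    (SimpleGraph.cycleGraph n).Adj a b ↔ a.val + 1 = b.val ∨ b.val + 1 = a.val ∨
      (a.val = 0 ∧ b.val + 1 = n) ∨ (b.val = 0 ∧ a.val + 1 = n) := by
  have key : ∀ a b : Fin n, (a - b).val = if b.val ≤ a.val then a.val - b.val
      else n - b.val + a.val := by
    intro a b
    split_ifs with h
    · exact Fin.sub_val_of_le h
    · rw [Fin.sub_def]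
      exact Nat.mod_eq_of_lt (by omega)
  rw [SimpleGraph.cycleGraph_adj', key a b, key b a]
  have := a.2
  have := b.2
  split_ifs <;> omega

/-- The spanning subgraph of `G` whose edges are those with both ends in `W`. -/
def restrict {V : Type*} (G : SimpleGraph V) (W : Set V) : SimpleGraph V where
  Adj a b := G.Adj a b ∧ a ∈ W ∧ b ∈ W
  symm := ⟨fun _ _ h => ⟨h.1.symm, h.2.2, h.2.1⟩⟩
  loopless := ⟨fun _ h => h.1.ne rfl⟩

theorem restrict_mono {V : Type*} (G : SimpleGraph V) {W W' : Set V} (h : W ⊆ W') :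
    restrict G W ≤ restrict G W' := fun _ _ hab => ⟨hab.1, h hab.2.1, h hab.2.2⟩

/-- A shortest walk from `x` to `y` through `W` is induced, and `u` sees only its ends, so `u`
closes it into a hole. -/
theorem not_isChordal_of_reachable {V : Type*} (G : SimpleGraph V) (W : Set V) (u x y : V)
    (hW : ∀ w ∈ W, w ≠ u ∧ ¬ G.Adj u w) (hx : G.Adj u x) (hy : G.Adj u y) (hxy : x ≠ y)
    (hnadj : ¬ G.Adj x y) (hr : (restrict G (W ∪ {x, y})).Reachable x y) : ¬ IsChordal G := by
  set H := restrict G (W ∪ {x, y})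
  obtain ⟨p, hp⟩ := hr.exists_walk_length_eq_dist
  -- Initial segments of a shortest walk are shortest. As adjacent vertices have distances from `x`
  -- differing by at most 1, the walk has no chords.
  have hd : ∀ i ≤ p.length, H.dist x (p.getVert i) = i := by
    intro i hi
    rw [← SimpleGraph.length_eq_dist_of_subwalk hp (p.isSubwalk_take i)]
    simp [hi]
  have hreach : ∀ i, H.Reachable x (p.getVert i) := fun i => ⟨p.take i⟩
  have hinj : ∀ i ≤ p.length, ∀ j ≤ p.length, p.getVert i = p.getVert j → i = j := by
    intro i hi j hj h
    rw [← hd i hi, h, hd j hj]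
  have hadjH : ∀ i ≤ p.length, ∀ j ≤ p.length,
      (H.Adj (p.getVert i) (p.getVert j) ↔ i + 1 = j ∨ j + 1 = i) := by
    intro i hi j hj
    constructor
    · intro h
      have h1 := SimpleGraph.Adj.diff_dist_adj (u := x) h
      rw [hd i hi, hd j hj] at h1
      have h2 : i ≠ j := by
        rintro rfl
        exact h.ne rfl
      omega
    · rintro (rfl | rfl)
      · exact p.adj_getVert_succ (by omega)
      · exact (p.adj_getVert_succ (by omega)).symm
  have hlen : 2 ≤ p.length := by
    by_contra hlt
    have h0 : p.length ≠ 0 := fun h => hxy (SimpleGraph.Walk.eq_of_length_eq_zero h)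
    have h1 : p.length = 1 := by omega
    exact hnadj (SimpleGraph.Walk.adj_of_length_eq_one h1).1
  have hmem : ∀ i ≤ p.length, p.getVert i ∈ W ∪ {x, y} := by
    intro i hi
    rcases Nat.lt_or_ge i p.length with h | h
    · exact (p.adj_getVert_succ h).2.1
    · have := (p.adj_getVert_succ (i := i - 1) (by omega)).2.2
      rwa [show i - 1 + 1 = i by omega] at this
  have hadj : ∀ i ≤ p.length, ∀ j ≤ p.length,
      (G.Adj (p.getVert i) (p.getVert j) ↔ i + 1 = j ∨ j + 1 = i) := by
    intro i hi j hj
    rw [← hadjH i hi j hj]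
    exact ⟨fun h => ⟨h, hmem i hi, hmem j hj⟩, fun h => h.1⟩
  have hne : ∀ i ≤ p.length, p.getVert i ≠ u := by
    intro i hi
    rcases hmem i hi with h | h | h
    · exact (hW _ h).1
    · rw [h]; exact hx.ne'
    · rw [h]; exact hy.ne'
  have hadju : ∀ i ≤ p.length, (G.Adj u (p.getVert i) ↔ i = 0 ∨ i = p.length) := by
    intro i hi
    constructor
    · intro h
      rcases hmem i hi with h' | h' | h'
      · exact absurd h (hW _ h').2
      · exact Or.inl (hinj _ hi _ (Nat.zero_le _) (by rw [h', p.getVert_zero]))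
      · exact Or.inr (hinj _ hi _ le_rfl (by rw [h', p.getVert_length]))
    · rintro (rfl | rfl)
      · rwa [p.getVert_zero]
      · rwa [p.getVert_length]
  intro hG
  refine hG (p.length + 2) (by omega) ⟨⟨⟨fun i => if i.val ≤ p.length then p.getVert i else u, ?_⟩,
    ?_⟩⟩
  · intro i j hij
    have hi := i.2
    have hj := j.2
    simp only at hij
    apply Fin.ext
    split_ifs at hij with h1 h2 h2
    · exact hinj _ h1 _ h2 hij
    · exact absurd hij (hne _ h1)
    · exact absurd hij.symm (hne _ h2)
    · omega
  · intro i j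
    have hi := i.2
    have hj := j.2
    rw [cycleGraph_adj_iff_val (by omega)]
    change G.Adj (if i.val ≤ p.length then p.getVert i else u)
      (if j.val ≤ p.length then p.getVert j else u) ↔ _
    split_ifs with h1 h2 h2
    · rw [hadj _ h1 _ h2]; omega
    · rw [G.adj_comm, hadju _ h1]; omega
    · rw [hadju _ h2]; omega
    · exact iff_of_false (fun h => h.ne rfl) (by omega)

/-- Dirac's theorem, in the form that carries the induction: inside `A`, every vertex with a
non-neighbour has a simplicial non-neighbour. -/
theorem exists_simplicial_not_adj {V : Type*} {G : SimpleGraph V} (hG : IsChordal G) :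
    ∀ (A : Finset V) (u c : V), u ∈ A → c ∈ A → c ≠ u → ¬ G.Adj u c →
      ∃ w ∈ A, w ≠ u ∧ ¬ G.Adj u w ∧
        ∀ a ∈ A, ∀ b ∈ A, G.Adj w a → G.Adj w b → a ≠ b → G.Adj a b := by
  classical
  intro A
  induction A using Finset.strongInduction with
  | H A ih =>
  intro u c hu hc hcu huc
  set W : Set V := {w | w ∈ A ∧ w ≠ u ∧ ¬ G.Adj u w}
  -- `C` is the component of `c` among the non-neighbours of `u` in `A`, and `S` is its boundary.
  -- Every vertex of `S` is adjacent to `u`.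
  set C : Finset V := A.filter fun w => w ∈ W ∧ (restrict G W).Reachable c w
  set S : Finset V := A.filter fun s => s ∉ C ∧ ∃ w ∈ C, G.Adj w s
  have hcC : c ∈ C := Finset.mem_filter.2 ⟨hc, ⟨hc, hcu, huc⟩, .rfl⟩
  have hCW : ∀ w ∈ C, w ∈ W := fun w hw => (Finset.mem_filter.1 hw).2.1
  have hSu : ∀ s ∈ S, G.Adj u s := by
    intro s hs
    obtain ⟨hsA, hsC, w, hw, hws⟩ := Finset.mem_filter.1 hs
    by_contra hus
    have hsu : s ≠ u := by
      rintro rfl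
      exact (hCW w hw).2.2 hws.symm
    have hsW : s ∈ W := ⟨hsA, hsu, hus⟩
    refine hsC (Finset.mem_filter.2 ⟨hsA, hsW, (Finset.mem_filter.1 hw).2.2.trans ?_⟩)
    exact SimpleGraph.Adj.reachable ⟨hws, hCW w hw, hsW⟩
  have hSclique : ∀ x ∈ S, ∀ y ∈ S, x ≠ y → G.Adj x y := by
    intro x hx y hy hxy
    by_contra hnadj
    obtain ⟨-, -, a, ha, hax⟩ := Finset.mem_filter.1 hx
    obtain ⟨-, -, b, hb, hby⟩ := Finset.mem_filter.1 hy
    refine not_isChordal_of_reachable G W u x y (fun w hw => hw.2) (hSu x hx) (hSu y hy) hxy hnadj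
      ?_ hG
    have h1 : (restrict G (W ∪ {x, y})).Reachable x a :=
      SimpleGraph.Adj.reachable ⟨hax.symm, by simp, Or.inl (hCW a ha)⟩
    have h2 : (restrict G (W ∪ {x, y})).Reachable b y :=
      SimpleGraph.Adj.reachable ⟨hby, Or.inl (hCW b hb), by simp⟩
    have h3 : (restrict G W).Reachable a b :=
      (Finset.mem_filter.1 ha).2.2.symm.trans (Finset.mem_filter.1 hb).2.2
    exact (h1.trans (h3.mono (restrict_mono G Set.subset_union_left))).trans h2
  have hnbr : ∀ w ∈ C, ∀ a ∈ A, G.Adj w a → a ∈ C ∪ S := by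
    intro w hw a ha hwa
    by_cases haC : a ∈ C
    · exact Finset.mem_union_left _ haC
    · exact Finset.mem_union_right _ (Finset.mem_filter.2 ⟨ha, haC, w, hw, hwa⟩)
  suffices h : ∃ w ∈ C, ∀ a ∈ C ∪ S, ∀ b ∈ C ∪ S, G.Adj w a → G.Adj w b → a ≠ b → G.Adj a b by
    obtain ⟨w, hw, hsimp⟩ := h
    exact ⟨w, (hCW w hw).1, (hCW w hw).2.1, (hCW w hw).2.2, fun a ha b hb hwa hwb =>
      hsimp a (hnbr w hw a ha hwa) b (hnbr w hw b hb hwb) hwa hwb⟩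
  have hsub : C ∪ S ⊂ A := by
    refine (Finset.ssubset_iff_of_subset
      (Finset.union_subset (Finset.filter_subset _ _) (Finset.filter_subset _ _))).2 ⟨u, hu, ?_⟩
    rw [Finset.mem_union]
    rintro (h | h)
    · exact (hCW u h).2.1 rfl
    · exact (hSu u h).ne rfl
  -- It remains to find a simplicial vertex of `C ∪ S` outside `S`. Apply induction to a vertex of
  -- `S` with a non-neighbour; the result avoids the clique `S`. If there is none, all of `S` is
  -- universal, and any non-adjacent pair serves instead.
  by_cases hcl : ∀ a ∈ C ∪ S, ∀ b ∈ C ∪ S, a ≠ b → G.Adj a b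
  · exact ⟨c, hcC, fun a ha b hb _ _ hab => hcl a ha b hb hab⟩
  by_cases huniv : ∀ s ∈ S, ∀ b ∈ C ∪ S, b ≠ s → G.Adj s b
  · push Not at hcl
    obtain ⟨a, ha, b, hb, hab, hnab⟩ := hcl
    have haS : a ∉ S := fun h => hnab (huniv a h b hb hab.symm)
    obtain ⟨w, hw, hwa, hnaw, hsimp⟩ := ih _ hsub a b ha hb hab.symm hnab
    have hwS : w ∉ S := fun h => hnaw (huniv w h a ha hwa.symm).symm
    exact ⟨w, (Finset.mem_union.1 hw).resolve_right hwS, hsimp⟩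
  · push Not at huniv
    obtain ⟨s, hs, b, hb, hbs, hnsb⟩ := huniv
    obtain ⟨w, hw, hws, hnsw, hsimp⟩ := ih _ hsub s b (Finset.mem_union_right _ hs) hb hbs hnsb
    have hwS : w ∉ S := fun h => hnsw (hSclique s hs w h hws.symm)
    exact ⟨w, (Finset.mem_union.1 hw).resolve_right hwS, hsimp⟩

theorem exists_simplicial {V : Type*} {G : SimpleGraph V} (hG : IsChordal G) {A : Finset V}
    (hA : A.Nonempty) :
    ∃ w ∈ A, ∀ a ∈ A, ∀ b ∈ A, G.Adj w a → G.Adj w b → a ≠ b → G.Adj a b := by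
  by_cases hcl : ∀ a ∈ A, ∀ b ∈ A, a ≠ b → G.Adj a b
  · obtain ⟨c, hc⟩ := hA
    exact ⟨c, hc, fun a ha b hb _ _ hab => hcl a ha b hb hab⟩
  · push Not at hcl
    obtain ⟨a, ha, b, hb, hab, hnab⟩ := hcl
    obtain ⟨w, hw, -, -, h⟩ := exists_simplicial_not_adj hG A a b ha hb hab.symm hnab
    exact ⟨w, hw, h⟩

/-! ### Families of connected sets and local ratio -/

/-- `S` induces a connected subgraph of `G`: every cut of `S` is crossed by an edge. -/
def InducesConnected {V : Type*} (G : SimpleGraph V) (S : Set V) : Prop :=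
  ∀ A ⊆ S, A.Nonempty → (S \ A).Nonempty → ∃ a ∈ A, ∃ b ∈ S \ A, G.Adj a b

/-- `A` and `B` share a vertex or are joined by an edge. -/
def Touches {V : Type*} (G : SimpleGraph V) (A B : Set V) : Prop :=
  ∃ a ∈ A, ∃ b ∈ B, a = b ∨ G.Adj a b

section

variable {V : Type*} {G : SimpleGraph V}

theorem InducesConnected.exists_adj {S : Set V} (hS : InducesConnected G S) {v : V} (hv : v ∈ S)
    (hne : S ≠ {v}) : ∃ a ∈ S, a ≠ v ∧ G.Adj v a := by
  have : (S \ {v}).Nonempty := by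
    rw [Set.nonempty_iff_ne_empty, Ne, Set.sdiff_eq_empty]
    exact fun h => hne (Set.Subset.antisymm h (Set.singleton_subset_iff.2 hv))
  obtain ⟨a, rfl, b, hb, hab⟩ := hS {v} (Set.singleton_subset_iff.2 hv) ⟨v, rfl⟩ this
  exact ⟨b, hb.1, hb.2, hab⟩

/-- A connection through a simplicial vertex can be short-cut along the edge between its two
neighbours. -/
theorem InducesConnected.diff_singleton {S : Set V} (hS : InducesConnected G S) {v : V}
    (hv : ∀ a ∈ S, ∀ b ∈ S, G.Adj v a → G.Adj v b → a ≠ b → G.Adj a b) :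
    InducesConnected G (S \ {v}) := by
  by_cases hvS : v ∈ S
  swap
  · rwa [Set.sdiff_singleton_eq_self hvS]
  intro A hA hAne hBne
  by_contra hno
  push Not at hno
  obtain ⟨a, ha, b, hb, hab⟩ := hS A (hA.trans Set.sdiff_subset) hAne
    (hBne.mono (Set.sdiff_subset_sdiff_left Set.sdiff_subset))
  have hbv : b = v := by
    by_contra hbv
    exact hno a ha b ⟨⟨hb.1, hbv⟩, hb.2⟩ hab
  subst hbv
  obtain ⟨c, hc, d, hd, hcd⟩ := hS (insert b A)
    (Set.insert_subset hvS (hA.trans Set.sdiff_subset)) (Set.insert_nonempty _ _)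
    (hBne.mono fun x hx => ⟨hx.1.1, fun h => h.elim hx.1.2 hx.2⟩)
  have hd' : d ∈ (S \ {b}) \ A :=
    ⟨⟨hd.1, fun h => hd.2 (Or.inl h)⟩, fun h => hd.2 (Or.inr h)⟩
  rcases hc with rfl | hc
  · exact hno a ha d hd' (hv a (hA ha).1 d hd.1 hab.symm hcd (by rintro rfl; exact hd'.2 ha))
  · exact hno c hc d hd' hcd

/-- In a chordal graph, every finite nonempty family of connected sets has a member all of whose
touching members meet a common clique. -/
theorem exists_simplicial_index (hG : IsChordal G) {ι : Type*} (J : Finset ι) (hJ : J.Nonempty) :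
    ∀ (A : Finset V) (S : ι → Set V), (∀ i ∈ J, S i ⊆ A) → (∀ i ∈ J, (S i).Nonempty) →
      (∀ i ∈ J, InducesConnected G (S i)) →
      ∃ i ∈ J, ∃ K : Finset V, G.IsClique (K : Set V) ∧
        ∀ j ∈ J, Touches G (S i) (S j) → ((K : Set V) ∩ S j).Nonempty := by
  classical
  intro A
  induction A using Finset.strongInduction with
  | H A ih =>
  intro S hSA hSne hSc
  have hA : A.Nonempty := by
    obtain ⟨i, hi⟩ := hJ
    obtain ⟨a, ha⟩ := hSne i hi
    exact ⟨a, hSA i hi ha⟩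
  obtain ⟨v, hvA, hv⟩ := exists_simplicial hG hA
  by_cases hsing : ∃ i ∈ J, S i = {v}
  · obtain ⟨i, hi, hiv⟩ := hsing
    refine ⟨i, hi, A.filter fun a => a = v ∨ G.Adj v a, ?_, ?_⟩
    · intro a ha b hb hab
      obtain ⟨haA, ha⟩ := Finset.mem_filter.1 (Finset.mem_coe.1 ha)
      obtain ⟨hbA, hb⟩ := Finset.mem_filter.1 (Finset.mem_coe.1 hb)
      rcases ha with rfl | ha
      · exact hb.resolve_left hab.symm
      rcases hb with rfl | hb
      · exact ha.symm
      · exact hv a haA b hbA ha hb hab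
    · rintro j hj ⟨a, ha, b, hb, hab⟩
      rw [hiv] at ha
      obtain rfl : a = v := ha
      exact ⟨b, Finset.mem_coe.2 (Finset.mem_filter.2 ⟨hSA j hj hb, hab.imp_left Eq.symm⟩), hb⟩
  -- With no member equal to `{v}`, delete `v` from all members. Touching survives: a member
  -- containing `v` also contains a neighbour of `v`, and the neighbours of `v` form a clique.
  · push Not at hsing
    obtain ⟨i, hi, K, hK, hKJ⟩ := ih (A.erase v) (Finset.erase_ssubset hvA) (fun i => S i \ {v})
      (fun i hi a ha => Finset.mem_coe.2 (Finset.mem_erase.2 ⟨ha.2, hSA i hi ha.1⟩))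
      (fun i hi => by
        rw [Set.nonempty_iff_ne_empty, Ne, Set.sdiff_eq_empty]
        exact fun h => hsing i hi ((hSne i hi).subset_singleton_iff.1 h))
      (fun i hi => (hSc i hi).diff_singleton fun a ha b hb =>
        hv a (hSA i hi ha) b (hSA i hi hb))
    refine ⟨i, hi, K, hK, fun j hj hij => (hKJ j hj ?_).mono
      (Set.inter_subset_inter_right _ Set.sdiff_subset)⟩
    have htouch : ∀ i ∈ J, ∀ j ∈ J, ∀ b ∈ S j, v ∈ S i → v = b ∨ G.Adj v b →
        Touches G (S i \ {v}) (S j \ {v}) := by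
      intro i hi j hj b hb hvi hvb
      obtain ⟨a, ha, hav, hva⟩ := (hSc i hi).exists_adj hvi (hsing i hi)
      have : ∃ b ∈ S j, b ≠ v ∧ G.Adj v b := by
        rcases hvb with rfl | hvb
        · exact (hSc j hj).exists_adj hb (hsing j hj)
        · exact ⟨b, hb, hvb.ne', hvb⟩
      obtain ⟨b, hb, hbv, hvb⟩ := this
      refine ⟨a, ⟨ha, hav⟩, b, ⟨hb, hbv⟩, ?_⟩
      rw [or_iff_not_imp_left]
      exact hv a (hSA i hi ha) b (hSA j hj hb) hva hvb
    obtain ⟨a, ha, b, hb, hab⟩ := hij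
    by_cases hav : a = v
    · subst hav
      exact htouch i hi j hj b hb ha hab
    by_cases hbv : b = v
    · subst hbv
      obtain ⟨c, hc, d, hd, hcd⟩ := htouch j hj i hi a ha hb
        (hab.imp Eq.symm fun h => h.symm)
      exact ⟨d, hd, c, hc, hcd.imp Eq.symm fun h => h.symm⟩
    · exact ⟨a, ⟨ha, hav⟩, b, ⟨hb, hbv⟩, hab⟩

/-- The local ratio argument: in a chordal graph, some family of pairwise non-touching members of
a family of connected sets weighs at least as much as any fractional packing. -/
theorem exists_packing (hG : IsChordal G) [Fintype V] {ι : Type*} [Fintype ι] (S : ι → Set V)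
    (hSne : ∀ i, (S i).Nonempty) (hSc : ∀ i, InducesConnected G (S i)) :
    ∀ (J : Finset ι) (w : ι → ℝ), (∀ i ∉ J, w i ≤ 0) →
      ∃ I ⊆ J, (∀ i ∈ I, ∀ j ∈ I, i ≠ j → ¬ Touches G (S i) (S j)) ∧
        ∀ y : ι → ℝ, (∀ i, 0 ≤ y i) →
          (∀ K : Finset V, G.IsClique (K : Set V) → ∀ L : Finset ι,
            (∀ i ∈ L, ((K : Set V) ∩ S i).Nonempty) → ∑ i ∈ L, y i ≤ 1) →
          ∑ i, w i * y i ≤ ∑ i ∈ I, w i := by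
  classical
  intro J
  induction J using Finset.strongInduction with
  | H J ih =>
  intro w hw
  by_cases hneg : ∃ i ∈ J, w i ≤ 0
  · obtain ⟨i, hi, hwi⟩ := hneg
    obtain ⟨I, hI, h⟩ := ih (J.erase i) (Finset.erase_ssubset hi) w (fun j hj => by
      by_cases hji : j = i
      · rwa [hji]
      · exact hw j fun h => hj (Finset.mem_erase.2 ⟨hji, h⟩))
    exact ⟨I, hI.trans (Finset.erase_subset _ _), h⟩
  push Not at hneg
  rcases J.eq_empty_or_nonempty with rfl | hJ
  · refine ⟨∅, Finset.Subset.refl _, by simp, fun y hy _ => ?_⟩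
    rw [Finset.sum_empty]
    exact Finset.sum_nonpos fun i _ =>
      mul_nonpos_of_nonpos_of_nonneg (hw i (Finset.notMem_empty i)) (hy i)
  obtain ⟨i, hi, K, hK, hKJ⟩ := exists_simplicial_index hG J hJ Finset.univ S
    (fun _ _ => by simp) (fun i _ => hSne i) (fun i _ => hSc i)
  have hself : ∀ i, Touches G (S i) (S i) := fun i => by
    obtain ⟨a, ha⟩ := hSne i
    exact ⟨a, ha, a, ha, Or.inl rfl⟩
  set N := J.filter fun j => Touches G (S i) (S j)
  have hiN : i ∈ N := Finset.mem_filter.2 ⟨hi, hself i⟩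
  -- Subtract `w i` on all members touching `S i`. The total `y`-value on them is at most 1, so the
  -- fractional objective loses at most `w i`.
  obtain ⟨I, hI, hIpack, hIy⟩ := ih (J.erase i) (Finset.erase_ssubset hi)
    (fun j => w j - if j ∈ N then w i else 0) (fun j hj => by
      by_cases hji : j = i
      · simp [hji, hiN]
      · have hjJ : j ∉ J := fun h => hj (Finset.mem_erase.2 ⟨hji, h⟩)
        have hjN : j ∉ N := fun h => hjJ (Finset.mem_filter.1 h).1
        simpa [hjN] using hw j hjJ)
  have hbound : ∀ y : ι → ℝ, (∀ i, 0 ≤ y i) →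
      (∀ K : Finset V, G.IsClique (K : Set V) → ∀ L : Finset ι,
        (∀ i ∈ L, ((K : Set V) ∩ S i).Nonempty) → ∑ i ∈ L, y i ≤ 1) →
      ∑ j, w j * y j ≤ ∑ j ∈ I, (w j - if j ∈ N then w i else 0) + w i := by
    intro y hy hyK
    have h1 := hIy y hy hyK
    have h2 := hyK K hK N fun j hj =>
      hKJ j (Finset.mem_filter.1 hj).1 (Finset.mem_filter.1 hj).2
    have h3 : ∑ j, w j * y j =
        ∑ j, (w j - if j ∈ N then w i else 0) * y j + w i * ∑ j ∈ N, y j := by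
      simp [sub_mul, Finset.mul_sum]
    rw [h3]
    exact add_le_add h1 (mul_le_of_le_one_right (hneg i hi).le h2)
  have hiI : i ∉ I := fun h => Finset.notMem_erase i J (hI h)
  have hIJ : I ⊆ J := hI.trans (Finset.erase_subset _ _)
  -- The integral packing regains `w i`: either `I` already has a member touching `S i`, or `i` can
  -- be added.
  by_cases hmeet : ∃ j ∈ I, j ∈ N
  · refine ⟨I, hIJ, hIpack, fun y hy hyK => (hbound y hy hyK).trans ?_⟩
    obtain ⟨j, hj, hjN⟩ := hmeet
    have : w i ≤ ∑ j ∈ I, if j ∈ N then w i else 0 := by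
      refine le_trans (by simp [hjN]) (Finset.single_le_sum
        (f := fun j => if j ∈ N then w i else 0) (fun k _ => ?_) hj)
      have := hneg i hi
      split_ifs <;> linarith
    rw [Finset.sum_sub_distrib]
    linarith
  · push Not at hmeet
    have hno : ∀ j ∈ I, ¬ Touches G (S i) (S j) := fun j hj h =>
      hmeet j hj (Finset.mem_filter.2 ⟨hIJ hj, h⟩)
    refine ⟨insert i I, Finset.insert_subset hi hIJ, ?_,
      fun y hy hyK => (hbound y hy hyK).trans ?_⟩
    · intro j hj k hk hjk
      rcases Finset.mem_insert.1 hj with hj | hj <;> rcases Finset.mem_insert.1 hk with hk | hk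
      · exact absurd (hj.trans hk.symm) hjk
      · exact hj ▸ hno k hk
      · rw [hk]
        rintro ⟨a, ha, b, hb, hab⟩
        exact hno j hj ⟨b, hb, a, ha, hab.imp Eq.symm fun h => h.symm⟩
      · exact hIpack j hj k hk hjk
    · rw [Finset.sum_insert hiI, add_comm]
      refine add_le_add le_rfl (le_of_eq (Finset.sum_congr rfl fun j hj => ?_))
      simp [hmeet j hj]

end

/-! ### The polytope in packing variables -/

section

open Classical

variable {V : Type*} {G : SimpleGraph V}

theorem inducesConnected_of_isClique {S : Set V} (hS : G.IsClique S) : InducesConnected G S :=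
  fun _ hA ⟨a, ha⟩ ⟨b, hb⟩ =>
    ⟨a, ha, b, hb, hS (hA ha) hb.1 (by rintro rfl; exact hb.2 ha)⟩

theorem inducesConnected_range {n : ℕ} (f : SimpleGraph.pathGraph n ↪g G) :
    InducesConnected G (Set.range f) := by
  rintro A hA ⟨a, ha⟩ ⟨b, ⟨j, rfl⟩, hb⟩
  obtain ⟨i, rfl⟩ := hA ha
  by_contra hno
  push Not at hno
  obtain ⟨p⟩ := SimpleGraph.pathGraph_preconnected n i j
  refine hb ?_
  clear hb
  induction p with
  | nil => exact ha
  | @cons i k j hik _ ih =>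
    refine ih ?_
    by_contra hk
    exact hno _ ha (f k) ⟨⟨k, rfl⟩, hk⟩ (f.map_adj_iff.2 hik)

theorem card_inter_le_two_of_inducesPath {P K : Finset V} (hP : InducesPath G P)
    (hK : G.IsClique (K : Set V)) : (P ∩ K).card ≤ 2 := by
  by_contra! h
  obtain ⟨a, b, c, ha, hb, hc, hab, hac, hbc⟩ := Finset.two_lt_card_iff.1 h
  obtain ⟨n, -, f, hf⟩ := hP
  rw [Finset.mem_inter, ← Finset.mem_coe, ← hf] at ha hb hc
  obtain ⟨⟨i, rfl⟩, ha⟩ := ha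
  obtain ⟨⟨j, rfl⟩, hb⟩ := hb
  obtain ⟨⟨k, rfl⟩, hc⟩ := hc
  have h1 := f.map_adj_iff.1 (hK ha hb hab)
  have h2 := f.map_adj_iff.1 (hK ha hc hac)
  have h3 := f.map_adj_iff.1 (hK hb hc hbc)
  rw [SimpleGraph.pathGraph_adj] at h1 h2 h3
  omega

theorem exists_isMaxClique_superset [Fintype V] {K : Finset V} (hK : G.IsClique (K : Set V)) :
    ∃ K', IsMaxClique G K' ∧ K ⊆ K' := by
  obtain ⟨K', h, hK'⟩ := Finite.exists_le_maximal
    (p := fun S : Finset V => G.IsClique (S : Set V)) hK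
  exact ⟨K', hK', h⟩

/-- The vertices, triangles and induced paths of `G`. -/
abbrev Piece (G : SimpleGraph V) : Type _ := V ⊕ Triangle G ⊕ IndPath G

/-- The vertex set of a vertex, triangle or induced path. -/
def Piece.verts : Piece G → Finset V :=
  Sum.elim (fun v => {v}) (Sum.elim (fun T => T.1) fun P => P.1)

theorem Piece.verts_nonempty (i : Piece G) : (i.verts : Set V).Nonempty := by
  rcases i with v | T | P
  · exact ⟨v, by simp [verts]⟩
  · have : T.1.Nonempty := by
      rw [← Finset.card_pos, T.2.card_eq]
      norm_num
    exact this
  · obtain ⟨n, hn, f, hf⟩ := P.2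
    change (P.1 : Set V).Nonempty
    rw [← hf]
    exact ⟨f ⟨0, by omega⟩, _, rfl⟩

theorem Piece.inducesConnected (i : Piece G) : InducesConnected G (i.verts : Set V) := by
  rcases i with v | T | P
  · exact inducesConnected_of_isClique (by simp [verts])
  · exact inducesConnected_of_isClique T.2.isClique
  · obtain ⟨n, hn, f, hf⟩ := P.2
    change InducesConnected G (P.1 : Set V)
    rw [← hf]
    exact inducesConnected_range f

theorem sum_sum_filter_mem {ι : Type*} [Fintype ι] (S : ι → Finset V) (K : Finset V) (t : ι → ℝ) :
    ∑ v ∈ K, ∑ i with v ∈ S i, t i = ∑ i, ((S i ∩ K).card : ℝ) * t i := by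
  simp_rw [Finset.sum_filter]
  rw [Finset.sum_comm]
  refine Finset.sum_congr rfl fun i _ => ?_
  rw [← Finset.sum_filter, Finset.sum_const, nsmul_eq_mul, Finset.inter_comm,
    Finset.filter_mem_eq_inter]

variable [Fintype V]

/-- The change of variables that replaces each `x v` by the slack of the star inequality
of `v`. -/
noncomputable def toPacking (G : SimpleGraph V) : VarSpace G →ₗ[ℝ] (Piece G → ℝ) where
  toFun z := Sum.elim
    (fun v => z.1 v - ∑ T ∈ trianglesMeeting G {v} 1, z.2.1 T - ∑ P ∈ pathsMeeting G {v} 1, z.2.2 P)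
    (Sum.elim z.2.1 z.2.2)
  map_add' z z' := by
    funext i
    rcases i with v | T | P
    · simp only [Sum.elim_inl, Pi.add_apply, Prod.fst_add, Prod.snd_add, Finset.sum_add_distrib]
      ring
    · rfl
    · rfl
  map_smul' c z := by
    funext i
    rcases i with v | T | P
    · simp only [Sum.elim_inl, Pi.smul_apply, Prod.smul_fst, Prod.smul_snd, smul_eq_mul,
        ← Finset.mul_sum, RingHom.id_apply]
      ring
    · rfl
    · rfl

/-- The inverse of `toPacking`. -/
noncomputable def ofPacking (G : SimpleGraph V) : (Piece G → ℝ) →ₗ[ℝ] VarSpace G where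
  toFun y := (fun v => ∑ i with v ∈ Piece.verts i, y i, fun T => y (.inr (.inl T)),
    fun P => y (.inr (.inr P)))
  map_add' y y' := by
    refine Prod.ext (funext fun v => ?_) rfl
    simp [Finset.sum_add_distrib]
  map_smul' c y := by
    refine Prod.ext (funext fun v => ?_) rfl
    simp [Finset.mul_sum]

theorem trianglesMeeting_singleton (v : V) :
    trianglesMeeting G {v} 1 = Finset.univ.filter fun T : Triangle G => v ∈ T.1 := by
  ext T
  by_cases h : v ∈ T.1 <;> simp [trianglesMeeting, h]

theorem pathsMeeting_singleton (v : V) :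
    pathsMeeting G {v} 1 = Finset.univ.filter fun P : IndPath G => v ∈ P.1 := by
  ext P
  by_cases h : v ∈ P.1 <;> simp [pathsMeeting, h]

theorem sum_pieces_containing (y : Piece G → ℝ) (v : V) :
    ∑ i with v ∈ Piece.verts i, y i = y (.inl v) + ∑ T ∈ trianglesMeeting G {v} 1, y (.inr (.inl T))
      + ∑ P ∈ pathsMeeting G {v} 1, y (.inr (.inr P)) := by
  rw [Finset.sum_filter, Fintype.sum_sum_type, Fintype.sum_sum_type, trianglesMeeting_singleton,
    pathsMeeting_singleton, Finset.sum_filter, Finset.sum_filter, ← add_assoc]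
  simp only [Piece.verts, Sum.elim_inl, Sum.elim_inr, Finset.mem_singleton]
  congr!
  simp

theorem toPacking_ofPacking (y : Piece G → ℝ) : toPacking G (ofPacking G y) = y := by
  funext i
  rcases i with v | T | P
  · change ∑ i with v ∈ Piece.verts i, y i - ∑ T ∈ trianglesMeeting G {v} 1, y (.inr (.inl T))
      - ∑ P ∈ pathsMeeting G {v} 1, y (.inr (.inr P)) = _
    rw [sum_pieces_containing]
    ring
  · rfl
  · rfl

theorem ofPacking_toPacking (z : VarSpace G) : ofPacking G (toPacking G z) = z := by
  refine Prod.ext (funext fun v => ?_) rfl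
  change ∑ i with v ∈ Piece.verts i, toPacking G z i = _
  rw [sum_pieces_containing]
  change z.1 v - ∑ T ∈ trianglesMeeting G {v} 1, z.2.1 T - ∑ P ∈ pathsMeeting G {v} 1, z.2.2 P
    + ∑ T ∈ trianglesMeeting G {v} 1, z.2.1 T + ∑ P ∈ pathsMeeting G {v} 1, z.2.2 P = _
  ring

/-- In the packing variables, the left-hand side of a clique inequality counts the pieces that
meet the clique. -/
theorem clique_sum_eq (z : VarSpace G) {K : Finset V} (hK : G.IsClique (K : Set V)) :
    ∑ v ∈ K, z.1 v - ∑ T ∈ trianglesMeeting G K 2, z.2.1 T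
        - 2 * ∑ T ∈ trianglesMeeting G K 3, z.2.1 T - ∑ P ∈ pathsMeeting G K 2, z.2.2 P
      = ∑ i with (Piece.verts i ∩ K).Nonempty, toPacking G z i := by
  have hx : ∑ v ∈ K, toPacking G z (.inl v) = ∑ v ∈ K, z.1 v
      - ∑ T : Triangle G, ((T.1 ∩ K).card : ℝ) * z.2.1 T
      - ∑ P : IndPath G, ((P.1 ∩ K).card : ℝ) * z.2.2 P := by
    rw [← sum_sum_filter_mem, ← sum_sum_filter_mem, ← Finset.sum_sub_distrib,
      ← Finset.sum_sub_distrib]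
    refine Finset.sum_congr rfl fun v _ => ?_
    rw [← trianglesMeeting_singleton, ← pathsMeeting_singleton]
    rfl
  have hT : ∑ T : Triangle G, (if (T.1 ∩ K).Nonempty then z.2.1 T else 0)
      = ∑ T : Triangle G, ((T.1 ∩ K).card : ℝ) * z.2.1 T - ∑ T ∈ trianglesMeeting G K 2, z.2.1 T
        - 2 * ∑ T ∈ trianglesMeeting G K 3, z.2.1 T := by
    simp only [trianglesMeeting, Finset.sum_filter, Finset.mul_sum, ← Finset.sum_sub_distrib]
    refine Finset.sum_congr rfl fun T _ => ?_
    have hle : (T.1 ∩ K).card ≤ 3 := (Finset.card_le_card Finset.inter_subset_left).trans_eq T.2.card_eq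
    simp only [← Finset.card_pos]
    -- The coefficient `c - [c = 2] - 2 * [c = 3]` is 1 for `c = 1, 2, 3` and 0 for `c = 0`.
    interval_cases h : (T.1 ∩ K).card <;> norm_num
    all_goals ring
  have hP : ∑ P : IndPath G, (if (P.1 ∩ K).Nonempty then z.2.2 P else 0)
      = ∑ P : IndPath G, ((P.1 ∩ K).card : ℝ) * z.2.2 P - ∑ P ∈ pathsMeeting G K 2, z.2.2 P := by
    simp only [pathsMeeting, Finset.sum_filter, ← Finset.sum_sub_distrib]
    refine Finset.sum_congr rfl fun P _ => ?_
    have hle := card_inter_le_two_of_inducesPath P.2 hK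
    simp only [← Finset.card_pos]
    interval_cases h : (P.1 ∩ K).card <;> norm_num
    all_goals ring
  rw [Finset.sum_filter, Fintype.sum_sum_type, Fintype.sum_sum_type]
  have h1 : ∑ v, (if ((Piece.verts (.inl v : Piece G)) ∩ K).Nonempty then toPacking G z (.inl v)
      else 0) = ∑ v ∈ K, toPacking G z (.inl v) := by
    rw [← Finset.sum_filter]
    refine Finset.sum_congr ?_ fun _ _ => rfl
    ext v
    refine Finset.mem_filter.trans ?_
    by_cases h : v ∈ K <;> simp [Piece.verts, h]
  rw [h1, hx]
  change _ = _ + (∑ T : Triangle G, (if (T.1 ∩ K).Nonempty then z.2.1 T else 0) +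
    ∑ P : IndPath G, (if (P.1 ∩ K).Nonempty then z.2.2 P else 0))
  rw [hT, hP]
  ring

theorem mem_polytope_iff (z : VarSpace G) :
    z ∈ polytope G ↔ (∀ i, 0 ≤ toPacking G z i) ∧ ∀ K, IsMaxClique G K →
      ∑ i with (Piece.verts i ∩ K).Nonempty, toPacking G z i ≤ 1 := by
  obtain ⟨x, t, p⟩ := z
  change (_ ∧ _ ∧ _ ∧ _) ↔ _
  constructor
  · rintro ⟨hK, hv, hp, ht⟩
    refine ⟨?_, fun K h => ?_⟩
    · rintro (v | T | P)
      · have := hv v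
        change 0 ≤ x v - _ - _
        linarith
      · exact ht T
      · exact hp P
    · rw [← clique_sum_eq _ h.1]
      exact hK K h
  · rintro ⟨h0, hK⟩
    refine ⟨fun K h => ?_, fun v => ?_, fun P => h0 (.inr (.inr P)), fun T => h0 (.inr (.inl T))⟩
    · have := hK K h
      rwa [← clique_sum_eq _ h.1] at this
    · have := h0 (.inl v)
      change 0 ≤ x v - _ - _ at this
      linarith

theorem sum_le_one_of_mem_polytope {z : VarSpace G} (hz : z ∈ polytope G) {K : Finset V}
    (hK : G.IsClique (K : Set V)) (L : Finset (Piece G))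
    (hL : ∀ i ∈ L, ((K : Set V) ∩ i.verts).Nonempty) : ∑ i ∈ L, toPacking G z i ≤ 1 := by
  obtain ⟨h0, h1⟩ := (mem_polytope_iff z).1 hz
  obtain ⟨K', hK', hKK'⟩ := exists_isMaxClique_superset hK
  refine le_trans (Finset.sum_le_sum_of_subset_of_nonneg (fun i hi => ?_) fun i _ _ => h0 i)
    (h1 K' hK')
  obtain ⟨a, ha, hai⟩ := hL i hi
  exact Finset.mem_filter.2 ⟨Finset.mem_univ i, a, Finset.mem_inter.2 ⟨hai, hKK' ha⟩⟩

theorem isBounded_polytope (G : SimpleGraph V) : Bornology.IsBounded (polytope G) := by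
  have hc : IsCompact (ofPacking G '' Set.Icc 0 1) :=
    isCompact_Icc.image (LinearMap.continuous_of_finiteDimensional _)
  refine hc.isBounded.subset fun z hz => ⟨toPacking G z, ⟨?_, fun i => ?_⟩, ofPacking_toPacking z⟩
  · exact ((mem_polytope_iff z).1 hz).1
  · obtain ⟨v, hv⟩ := i.verts_nonempty
    simpa using sum_le_one_of_mem_polytope hz (K := {v}) (by simp) {i} (by simpa using hv)

theorem isIntegerPoint_ofPacking {y : Piece G → ℝ} (hy : ∀ i, ∃ m : ℤ, y i = m) :
    IsIntegerPoint (ofPacking G y) := by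
  refine ⟨fun v => ?_, fun T => hy _, fun P => hy _⟩
  choose m hm using hy
  exact ⟨∑ i with v ∈ Piece.verts i, m i, by simp [ofPacking, hm]⟩

theorem IsIntegerPoint.toPacking {z : VarSpace G} (hz : IsIntegerPoint z) (i : Piece G) :
    ∃ m : ℤ, toPacking G z i = m := by
  obtain ⟨hx, ht, hp⟩ := hz
  rcases i with v | T | P
  · choose x hx using hx
    choose t ht using ht
    choose p hp using hp
    refine ⟨x v - ∑ T ∈ trianglesMeeting G {v} 1, t T - ∑ P ∈ pathsMeeting G {v} 1, p P, ?_⟩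
    change z.1 v - ∑ T ∈ trianglesMeeting G {v} 1, z.2.1 T - ∑ P ∈ pathsMeeting G {v} 1, z.2.2 P
      = _
    simp [hx, ht, hp]
  · exact ht T
  · exact hp P

/-! ### The two directions of the equivalence -/

theorem isInteger_of_isChordal (hG : IsChordal G) : IsInteger (polytope G) := by
  intro F hF hFne
  obtain ⟨l, rfl⟩ := hF hFne
  set w : Piece G → ℝ := fun i => l (ofPacking G (Pi.single i 1))
  have hl : ∀ y : Piece G → ℝ, l (ofPacking G y) = ∑ i, w i * y i := by
    intro y
    conv_lhs => rw [pi_eq_sum_univ' y]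
    simp only [map_sum, map_smul, smul_eq_mul]
    refine Finset.sum_congr rfl fun i _ => ?_
    rw [mul_comm]
  obtain ⟨I, -, hI, hIw⟩ := exists_packing hG (fun i : Piece G => (i.verts : Set V))
    Piece.verts_nonempty Piece.inducesConnected Finset.univ w (by simp)
  refine ⟨ofPacking G fun i => if i ∈ I then 1 else 0, ⟨?_, fun z hz => ?_⟩,
    isIntegerPoint_ofPacking fun i => ?_⟩
  · rw [mem_polytope_iff, toPacking_ofPacking]
    refine ⟨fun i => by split_ifs <;> norm_num, fun K hK => ?_⟩
    rw [Finset.sum_boole]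
    norm_cast
    refine Finset.card_le_one.2 fun i hi j hj => ?_
    simp only [Finset.mem_filter, Finset.mem_univ, true_and] at hi hj
    by_contra hij
    obtain ⟨a, ha⟩ := hi.1
    obtain ⟨b, hb⟩ := hj.1
    rw [Finset.mem_inter] at ha hb
    refine hI i hi.2 j hj.2 hij ⟨a, ha.1, b, hb.1, ?_⟩
    rw [or_iff_not_imp_left]
    exact hK.1 ha.2 hb.2
  · rw [← ofPacking_toPacking z, hl, hl]
    refine (hIw (toPacking G z) ((mem_polytope_iff z).1 hz).1
      fun K hK L hL => sum_le_one_of_mem_polytope hz hK L hL).trans (le_of_eq ?_)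
    simp
  · by_cases h : i ∈ I
    · exact ⟨1, by simp [h]⟩
    · exact ⟨0, by simp [h]⟩

theorem toPacking_add_le_one {z : VarSpace G} (hz : z ∈ polytope G) {i j : Piece G} (hij : i ≠ j)
    (h : Touches G (i.verts : Set V) j.verts) : toPacking G z i + toPacking G z j ≤ 1 := by
  obtain ⟨a, ha, b, hb, hab⟩ := h
  rw [← Finset.sum_pair hij]
  refine sum_le_one_of_mem_polytope hz (K := {a, b}) ?_ {i, j} ?_
  · rw [Finset.coe_pair, SimpleGraph.isClique_pair]
    exact fun h => hab.resolve_left h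
  · intro k hk
    rcases Finset.mem_insert.1 hk with rfl | hk
    · exact ⟨a, by simp, ha⟩
    · rw [Finset.mem_singleton.1 hk]
      exact ⟨b, by simp, hb⟩

/-- Three pairwise touching pieces that no clique meets simultaneously obstruct integrality. -/
theorem not_isInteger_of_touching_triple {i j k : Piece G} (hij : i ≠ j) (hik : i ≠ k) (hjk : j ≠ k)
    (tij : Touches G (i.verts : Set V) j.verts) (tik : Touches G (i.verts : Set V) k.verts)
    (tjk : Touches G (j.verts : Set V) k.verts)
    (hno : ∀ K : Finset V, G.IsClique (K : Set V) → (i.verts ∩ K).Nonempty →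
      (j.verts ∩ K).Nonempty → ¬ (k.verts ∩ K).Nonempty) : ¬ IsInteger (polytope G) := by
  intro hint
  let l : VarSpace G →L[ℝ] ℝ := LinearMap.toContinuousLinearMap
    (((LinearMap.proj i : (Piece G → ℝ) →ₗ[ℝ] ℝ) + LinearMap.proj j + LinearMap.proj k) ∘ₗ
      toPacking G)
  have hl : ∀ z, l z = toPacking G z i + toPacking G z j + toPacking G z k := fun z => rfl
  have hle : ∀ z ∈ polytope G, l z ≤ 3 / 2 := by
    intro z hz
    have h1 := toPacking_add_le_one hz hij tij
    have h2 := toPacking_add_le_one hz hik tik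
    have h3 := toPacking_add_le_one hz hjk tjk
    rw [hl]
    linarith
  -- Half of each of the three pieces is feasible, since a clique meets at most two of them.
  set z₀ := ofPacking G fun m => if m ∈ ({i, j, k} : Finset (Piece G)) then 1 / 2 else 0 with hz₀
  have hval : l z₀ = 3 / 2 := by
    rw [hl, hz₀, toPacking_ofPacking]
    norm_num
  have hmem : z₀ ∈ polytope G := by
    rw [mem_polytope_iff, hz₀, toPacking_ofPacking]
    refine ⟨fun i => by split_ifs <;> norm_num, fun K hK => ?_⟩
    rw [← Finset.sum_filter, Finset.sum_const, nsmul_eq_mul]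
    have hlt : ((Finset.univ.filter fun m : Piece G => (m.verts ∩ K).Nonempty).filter
        fun m => m ∈ ({i, j, k} : Finset (Piece G))).card < 3 := by
      refine (Finset.card_lt_card ((Finset.ssubset_iff_of_subset
        fun m hm => (Finset.mem_filter.1 hm).2).2 ?_)).trans_eq
        (Finset.card_eq_three.2 ⟨i, j, k, hij, hik, hjk, rfl⟩)
      by_contra hall
      push Not at hall
      have h : ∀ m ∈ ({i, j, k} : Finset (Piece G)), (m.verts ∩ K).Nonempty := fun m hm =>
        (Finset.mem_filter.1 (Finset.mem_filter.1 (hall m hm)).1).2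
      exact hno K hK.1 (h i (by simp)) (h j (by simp)) (h k (by simp))
    have : (((Finset.univ.filter fun m : Piece G => (m.verts ∩ K).Nonempty).filter
        fun m => m ∈ ({i, j, k} : Finset (Piece G))).card : ℝ) ≤ 2 := by
      exact_mod_cast Nat.lt_succ_iff.1 hlt
    linarith
  obtain ⟨z, hz, hzint⟩ := hint (l.toExposed (polytope G)) ContinuousLinearMap.toExposed.isExposed
    ⟨z₀, hmem, fun z hz => (hle z hz).trans hval.ge⟩
  have heq : l z = 3 / 2 := le_antisymm (hle z hz.1) (hval ▸ hz.2 z₀ hmem)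
  obtain ⟨a, ha⟩ := hzint.toPacking i
  obtain ⟨b, hb⟩ := hzint.toPacking j
  obtain ⟨c, hc⟩ := hzint.toPacking k
  rw [hl, ha, hb, hc] at heq
  have : 2 * (a + b + c) = 3 := by
    have : (2 * (a + b + c) : ℝ) = 3 := by linarith
    exact_mod_cast this
  omega

theorem isChordal_of_isInteger (hint : IsInteger (polytope G)) : IsChordal G := by
  rintro n hn ⟨f⟩
  have hadj : ∀ a b : Fin n, G.Adj (f a) (f b) ↔ _ := fun a b =>
    f.map_adj_iff.trans (cycleGraph_adj_iff_val (by omega) a b)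
  -- The hole without its vertices 0 and 1 is an induced path; it has an edge because `4 ≤ n`.
  let g : SimpleGraph.pathGraph (n - 2) ↪g G :=
    { toFun := fun i => f ⟨i.val + 2, by omega⟩
      inj' := fun i j h => Fin.ext (by simpa using f.injective h)
      map_rel_iff' := fun {i j} => by
        change G.Adj (f ⟨i.val + 2, _⟩) (f ⟨j.val + 2, _⟩) ↔ _
        rw [hadj, SimpleGraph.pathGraph_adj]
        have := i.2
        have := j.2
        simp only
        omega }
  let P : IndPath G := ⟨Finset.univ.image g, n - 2, by omega, g, by simp⟩
  have hP : ∀ a : Fin n, 2 ≤ a.val → f a ∈ (P.1 : Set V) := by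
    intro a ha
    refine Finset.mem_coe.2 (Finset.mem_image.2 ⟨⟨a.val - 2, by omega⟩, Finset.mem_univ _, ?_⟩)
    exact congrArg f (Fin.ext (Nat.sub_add_cancel ha))
  have hmem : ∀ a : Fin n, f a ∈ ((Piece.verts (.inl (f a) : Piece G) : Finset V) : Set V) :=
    fun a => by simp [Piece.verts]
  let a₀ : Fin n := ⟨0, by omega⟩
  let a₁ : Fin n := ⟨1, by omega⟩
  have h01 : a₀ ≠ a₁ := by simp [a₀, a₁]
  refine not_isInteger_of_touching_triple (i := .inl (f a₀)) (j := .inl (f a₁))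
    (k := .inr (.inr P)) (fun h => h01 (f.injective (Sum.inl_injective h))) Sum.inl_ne_inr
    Sum.inl_ne_inr ?_ ?_ ?_ ?_ hint
  · exact ⟨f a₀, hmem _, f a₁, hmem _, Or.inr ((hadj _ _).2 (Or.inl rfl))⟩
  · refine ⟨f a₀, hmem _, f ⟨n - 1, by omega⟩, hP _ (by simp only; omega),
      Or.inr ((hadj _ _).2 (Or.inr (Or.inr (Or.inl ⟨rfl, Nat.sub_add_cancel (by omega)⟩))))⟩
  · exact ⟨f a₁, hmem _, f ⟨2, by omega⟩, hP _ le_rfl, Or.inr ((hadj _ _).2 (Or.inl rfl))⟩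
  · rintro K hK ⟨u, hu⟩ ⟨v, hv⟩ ⟨b, hb⟩
    rw [Finset.mem_inter] at hu hv hb
    obtain rfl : u = f a₀ := Finset.mem_singleton.1 hu.1
    obtain rfl : v = f a₁ := Finset.mem_singleton.1 hv.1
    obtain ⟨c, -, rfl⟩ := Finset.mem_image.1 hb.1
    -- The only path vertex adjacent to hole vertex 0 is `n - 1`, and the only one adjacent to 1 is
    -- 2; these differ as `4 ≤ n`.
    have hc := c.2
    have h0 : G.Adj (f a₀) (f ⟨c.val + 2, by omega⟩) := hK hu.2 hb.2 fun h => by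
      simpa [a₀] using f.injective h
    have h1 : G.Adj (f a₁) (f ⟨c.val + 2, by omega⟩) := hK hv.2 hb.2 fun h => by
      simpa [a₁] using f.injective h
    rw [hadj] at h0 h1
    simp only [a₀, a₁] at h0 h1
    omega

end

end CoThreePlex

theorem mainTheorem1 {V : Type*} [Fintype V] (G : SimpleGraph V) :
    Bornology.IsBounded (CoThreePlex.polytope G) ∧
      (CoThreePlex.IsChordal G ↔ CoThreePlex.IsInteger (CoThreePlex.polytope G)) :=
  ⟨CoThreePlex.isBounded_polytope G, CoThreePlex.isInteger_of_isChordal,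
    CoThreePlex.isChordal_of_isInteger⟩
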